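/- Let $X$ be a completely regular (not necessarily Hausdorff) topological space in which compact sets are Borel sets. Let $(\mu_\alpha)$ be a net of Borel probability measures on $X$ and $(t_\alpha)$ a net in $]0,+\infty[$, with the same index set, converging to $0$. Write $\mu_\alpha^{t_\alpha}(S)=\mu_\alpha(S)^{t_\alpha}$ for a Borel set $S$, and, for a Borel function $h:X\to[-\infty,+\infty[$, write $\mu_\alpha^{t_\alpha}(e^{h/t_\alpha})=\bigl(\int_X e^{h(x)/t_\alpha}\,\mu_\alpha(dx)\bigr)^{t_\alpha}$, $$\overline\Lambda(h)=\log\limsup_\alpha\mu_\alpha^{t_\alpha}(e^{h/t_\alpha}),\qquad \underline\Lambda(h)=\log\liminf_\alpha\mu_\alpha^{t_\alpha}(e^{h/t_\alpha}),$$ and $\Lambda(h)=\log\lim_\alpha\mu_\alpha^{t_\alpha}(e^{h/t_\alpha})$ when this limit exists in $[0,+\infty]$. Let $\mathcal C(X)$ be the set of all real-valued continuous functions on $X$. For $\mathcal A\subset\mathcal C(X)$ put $\mathcal A_-=\{h\in\mathcal A: h\le 0\}$ and $\mathcal A_{ba}=\{h\in\mathcal A: h \text{ is bounded above}\}$. For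 $h\in\mathcal C(X)$ and $M\in\mathbb R$, let $h_M=h$ on $\{h<M\}$ and $h_M=-\infty$ on $\{h\ge M\}$. Suppose that $(\mu_\alpha)$ satisfies a large deviation principle with powers $(t_\alpha)$ and rate function $J$; that is, there is $l:X\to[0,+\infty]$ such that $\limsup_\alpha\mu_\alpha^{t_\alpha}(F)\le\sup_{x\in F}e^{-l(x)}$ for all closed $F\subset X$ and $\sup_{x\in G}e^{-l(x)}\le\liminf_\alpha\mu_\alpha^{t_\alpha}(G)$ for all open $G\subset X$, and $J$ is the greatest lower semicontinuous function with $J\le l$. 1. For every $h\in\mathcal C(X)_-$, $\Lambda(h)$ exists; for every $h\in\mathcal C(X)$, $\lim_{M\to+\infty}\underline\Lambda(h_M)$ exists in $[-\infty,+\infty]$; and for all $x\in X$, $$J(x)=\sup_{h\in\mathcal C(X)_-}\{h(x)-\Lambda(h)\}=\sup_{h\in\mathcal C(X)}\{h(x)-\overline\Lambda(h)\}=\sup_{h\in\mathcal C(X)}\{h(x)-\underline\Lambda(h)\}=\sup_{h\in\mathcal C(X)}\Bigl\{h(x)-\lim_{M\to+\infty}\underline\Lambda(h_M)\Bigr\}.$$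 2. Suppose moreover that $(\mu_\alpha)$ is exponentially tight with respect to $(t_\alpha)$: for each $\varepsilon>0$ there is a compact $K\subset X$ with $\limsup_\alpha\mu_\alpha^{t_\alpha}(X\setminus K)<\varepsilon$. Let $\mathcal A\subset\mathcal C(X)$ be either an algebra (a linear subspace closed under products, not necessarily containing the constants) that separates the points of $X$, or a well-separating class (it contains the constant functions, is closed under finite pointwise minima, and for all $x\ne y$ in $X$ and all $a,b\in\mathbb R$ contains some $h$ with $h(x)=a$ and $h(y)=b$). Then $\Lambda(h)$ exists for every $h\in\mathcal A_{ba}$, and for all $x\in X$, $$J(x)=\sup_{h\in\mathcal A_{ba}}\{h(x)-\Lambda(h)\}=\sup_{h\in\mathcal A}\{h(x)-\overline\Lambda(h)\}=\sup_{h\in\mathcal A}\{h(x)-\underline\Lambda(h)\}=\sup_{h\in\mathcal A}\Bigl\{h(x)-\lim_{M\to+\infty}\underline\Lambda(h_M)\Bigr\}.$$ If in addition for each $x\in X$ there is $h\in\mathcal A$ with $h(x)\ne0$, then also $J(x)=\sup_{h\in\mathcal A_-}\{h(x)-\Lambda(h)\}$ for all $x\in X$. -/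

import Mathlib

open Filter Topology MeasureTheory
open scoped ENNReal

namespace LargeDev

section Net

variable {X ι : Type*} [TopologicalSpace X] [MeasurableSpace X] [Preorder ι]

/-- The real power `μ_α(S)^{t_α}`. -/
noncomputable def powMeasure (μ : ι → Measure X) (t : ι → ℝ) (S : Set X) (α : ι) : ℝ≥0∞ :=
  (μ α S) ^ (t α)

/-- `μ_α^{t_α}(e^{h/t_α}) = (∫ e^{h/t_α} dμ_α)^{t_α}`, with `e^{-∞} = 0`. -/
noncomputable def powIntegral (μ : ι → Measure X) (t : ι → ℝ) (h : X → EReal) (α : ι) : ℝ≥0∞ :=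
  (∫⁻ x, EReal.exp (h x / (t α : EReal)) ∂(μ α)) ^ (t α)

/-- `Λ̄(h) = log limsup μ_α^{t_α}(e^{h/t_α})`, with `log 0 = -∞` and `log ∞ = ∞`. -/
noncomputable def upperLambda (μ : ι → Measure X) (t : ι → ℝ) (h : X → EReal) : EReal :=
  ENNReal.log (limsup (powIntegral μ t h) atTop)

/-- `Λ̲(h) = log liminf μ_α^{t_α}(e^{h/t_α})`. -/
noncomputable def lowerLambda (μ : ι → Measure X) (t : ι → ℝ) (h : X → EReal) : EReal :=
  ENNReal.log (liminf (powIntegral μ t h) atTop)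

/-- `Λ(h)` exists: the net `μ_α^{t_α}(e^{h/t_α})` converges in `[0, ∞]`. -/
def LambdaExists (μ : ι → Measure X) (t : ι → ℝ) (h : X → EReal) : Prop :=
  ∃ L : ℝ≥0∞, Tendsto (powIntegral μ t h) atTop (𝓝 L)

/-- `Λ(h) = log lim μ_α^{t_α}(e^{h/t_α})`; meaningful when `LambdaExists μ t h`. -/
noncomputable def Lambda (μ : ι → Measure X) (t : ι → ℝ) (h : X → EReal) : EReal :=
  ENNReal.log (limUnder atTop (powIntegral μ t h))

/-- Large deviation upper bounds with powers `t` and function `l`. -/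
def UpperBounds (μ : ι → Measure X) (t : ι → ℝ) (l : X → ℝ≥0∞) : Prop :=
  ∀ F : Set X, IsClosed F →
    limsup (powMeasure μ t F) atTop ≤ ⨆ x ∈ F, EReal.exp (-(l x : EReal))

/-- Large deviation lower bounds with powers `t` and function `l`. -/
def LowerBounds (μ : ι → Measure X) (t : ι → ℝ) (l : X → ℝ≥0∞) : Prop :=
  ∀ G : Set X, IsOpen G →
    (⨆ x ∈ G, EReal.exp (-(l x : EReal))) ≤ liminf (powMeasure μ t G) atTop

/-- `μ` satisfies a large deviation principle with powers `t` and rate function `J`: the upper and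
the lower bounds hold with some `[0, ∞]`-valued function `l`, and `J` is the lower regularization
of `l`, that is the greatest lower semicontinuous function below `l`. -/
def SatisfiesLDP (μ : ι → Measure X) (t : ι → ℝ) (J : X → ℝ≥0∞) : Prop :=
  ∃ l : X → ℝ≥0∞, UpperBounds μ t l ∧ LowerBounds μ t l ∧
    IsGreatest {g : X → ℝ≥0∞ | LowerSemicontinuous g ∧ g ≤ l} J

/-- `μ` is exponentially tight with respect to `t`. -/
def ExponentiallyTight (μ : ι → Measure X) (t : ι → ℝ) : Prop :=
  ∀ ε : ℝ≥0∞, 0 < ε → ∃ K : Set X, IsCompact K ∧ limsup (powMeasure μ t Kᶜ) atTop < ε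

end Net

section Functions

variable {X : Type*} [TopologicalSpace X]

/-- A continuous real function, seen as an extended real valued function. -/
def toEReal (h : C(X, ℝ)) : X → EReal := fun x => ((h x : ℝ) : EReal)

/-- The truncation `h_M`, equal to `h` on `{h < M}` and to `-∞` on `{h ≥ M}`. -/
noncomputable def trunc (h : C(X, ℝ)) (M : ℝ) : X → EReal :=
  fun x => if h x < M then ((h x : ℝ) : EReal) else ⊥

/-- `lim_{M → +∞} Λ̲(h_M)`, the limit being taken in `[-∞, ∞]`. -/
noncomputable def limTruncLambda {ι : Type*} [MeasurableSpace X] [Preorder ι]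
    (μ : ι → Measure X) (t : ι → ℝ) (h : C(X, ℝ)) : EReal :=
  limUnder atTop (fun M : ℝ => lowerLambda μ t (trunc h M))

/-- The negative part `A_-` of `A`: its elements with values in `]-∞, 0]`. -/
def negPart (A : Set C(X, ℝ)) : Set C(X, ℝ) := {h | h ∈ A ∧ ∀ x, h x ≤ 0}

/-- The bounded above part `A_ba` of `A`: its elements that are bounded above. -/
def bddAbovePart (A : Set C(X, ℝ)) : Set C(X, ℝ) :=
  {h | h ∈ A ∧ BddAbove (Set.range (h : X → ℝ))}

/-- `A` is an algebra of continuous functions (not necessarily containing the constants)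
separating the points. -/
def IsSeparatingAlgebra (A : Set C(X, ℝ)) : Prop :=
  (∃ S : NonUnitalSubalgebra ℝ C(X, ℝ), (S : Set C(X, ℝ)) = A) ∧
    ∀ x y : X, x ≠ y → ∃ h ∈ A, h x ≠ h y

/-- `A` is a well-separating class: it contains the constants, is closed under finite minima, and
takes arbitrary pairs of values at any pair of distinct points. -/
def IsWellSeparating (A : Set C(X, ℝ)) : Prop :=
  (∀ c : ℝ, ContinuousMap.const X c ∈ A) ∧
    (∀ g ∈ A, ∀ h ∈ A, g ⊓ h ∈ A) ∧
    ∀ x y : X, x ≠ y → ∀ a b : ℝ, ∃ h ∈ A, h x = a ∧ h y = b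

/-- `A` does not vanish identically at any point. -/
def VanishesNowhere (A : Set C(X, ℝ)) : Prop := ∀ x : X, ∃ h ∈ A, h x ≠ 0

end Functions

end LargeDev

namespace LargeDev

/-! The rate function `J` satisfies both large deviation bounds in place of `l`, and these give two
halves of Varadhan's lemma. If `h` is bounded above and `h ≤ s + J`, slicing by level sets gives
`upperLambda h ≤ s` (`upperLambda_le`). For any continuous `h` and `M > h x`, restricting the
integral to a slab around the level `h x` gives `h x - J x ≤ lowerLambda (trunc h M)`
(`sub_le_lowerLambda_trunc`).

The second half puts every supremum below `J x`, since `limTruncLambda ≤ lowerLambda ≤ upperLambda`.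
It remains to show `J x ≤ ⨆ (h x - upperLambda h)` over a class of functions bounded above. By the
first half it suffices, for `0 ≤ c < J x`, to find `h` in the class and `s` with `h ≤ s + J` and `h
x - s` nearly `c` (`le_iSup_sub_upperLambda`).

Since `{J > c}` is open, a bump function at `x` provides such an `h` when all continuous functions
are allowed. Under exponential tightness `J ≥ c` off a compact `K`, so `h` need only be controlled
from above globally and precisely on `K ∪ {x}`: finite minima do this for a well-separating class,
Stone–Weierstrass followed by a quadratic polynomial for an algebra. -/

theorem powIntegral_mono {X ι : Type*} [MeasurableSpace X] {μ : ι → Measure X} {t : ι → ℝ}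
    (ht : ∀ α, 0 < t α) {f g : X → EReal} (hfg : f ≤ g) :
    powIntegral μ t f ≤ powIntegral μ t g := fun α =>
  ENNReal.rpow_le_rpow (lintegral_mono fun x => EReal.exp_monotone
    (EReal.div_le_div_right_of_nonneg (by exact_mod_cast (ht α).le) (hfg x))) (ht α).le

theorem lowerLambda_mono {X ι : Type*} [MeasurableSpace X] [Preorder ι] {μ : ι → Measure X}
    {t : ι → ℝ} (ht : ∀ α, 0 < t α) {f g : X → EReal} (hfg : f ≤ g) :
    lowerLambda μ t f ≤ lowerLambda μ t g :=
  ENNReal.log_monotone (liminf_le_liminf (.of_forall (powIntegral_mono ht hfg)))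

theorem lowerLambda_le_upperLambda {X ι : Type*} [MeasurableSpace X] [Preorder ι]
    {μ : ι → Measure X} {t : ι → ℝ} [IsDirectedOrder ι] [Nonempty ι] (h : X → EReal) :
    lowerLambda μ t h ≤ upperLambda μ t h :=
  ENNReal.log_monotone liminf_le_limsup

theorem trunc_monotone {X : Type*} [TopologicalSpace X] (h : C(X, ℝ)) : Monotone (trunc h) := fun M N hMN x => by
  unfold trunc
  split_ifs with h1 h2
  · exact le_rfl
  · exact absurd (h1.trans_le hMN) h2
  · exact bot_le
  · exact le_rfl

theorem trunc_le {X : Type*} [TopologicalSpace X] (h : C(X, ℝ)) (M : ℝ) : trunc h M ≤ toEReal h := fun x => by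
  unfold trunc toEReal
  split_ifs <;> simp

theorem bddAbove_range_of_mem_negPart {X : Type*} [TopologicalSpace X] {A : Set C(X, ℝ)} {h : C(X, ℝ)} (hh : h ∈ negPart A) :
    BddAbove (Set.range (h : X → ℝ)) :=
  ⟨0, Set.forall_mem_range.2 hh.2⟩

theorem exp_div_rpow {r s : ℝ} (hs : 0 < s) :
    EReal.exp ((r : EReal) / (s : EReal)) ^ s = EReal.exp (r : EReal) := by
  rw [← EReal.exp_mul, ← EReal.coe_div, ← EReal.coe_mul, div_mul_cancel₀ _ hs.ne']

/-! ### Large deviation bounds for `J` and the two halves of Varadhan's lemma -/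

section Bounds

variable {X ι : Type*} [TopologicalSpace X] [MeasurableSpace X] [Preorder ι]
  {μ : ι → Measure X} {t : ι → ℝ} {J : X → ℝ≥0∞}

/-- The rate function of a large deviation principle is lower semicontinuous and satisfies the
upper and lower bounds itself. -/
theorem SatisfiesLDP.bounds (hJ : SatisfiesLDP μ t J) :
    LowerSemicontinuous J ∧ UpperBounds μ t J ∧ LowerBounds μ t J := by
  obtain ⟨l, hU, hL, ⟨hlsc, hle⟩, hub⟩ := hJ
  refine ⟨hlsc, fun F hF => (hU F hF).trans ?_, fun G hG => le_trans ?_ (hL G hG)⟩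
  · refine iSup₂_mono fun x _ => EReal.exp_monotone (EReal.neg_le_neg_iff.2 ?_)
    exact EReal.coe_ennreal_le_coe_ennreal_iff.2 (hle x)
  · refine iSup₂_le fun x hx => ?_
    -- As `G` is open, this function is lower semicontinuous and below `l`, so maximality of `J`
    -- gives `inf_G l ≤ J` on `G`.
    have h1 : G.indicator (fun _ => ⨅ y ∈ G, l y) ≤ J := by
      refine hub ⟨hG.lowerSemicontinuous_indicator zero_le, fun y => ?_⟩
      by_cases hy : y ∈ G
      · simpa [hy] using iInf₂_le y hy
      · simp [hy]
    have h2 : ⨅ y ∈ G, l y ≤ J x := by simpa [hx] using h1 x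
    by_contra! hlt
    obtain ⟨c, hc1, hc2⟩ := exists_between hlt
    refine (hc2.trans_le (EReal.exp_monotone (EReal.neg_le_neg_iff.2
      (EReal.coe_ennreal_le_coe_ennreal_iff.2 h2)))).not_ge ?_
    have h3 : ∀ y ∈ G, EReal.exp (-(l y : EReal)) ≤ c := fun y hy =>
      (le_iSup₂ (f := fun y (_ : y ∈ G) => EReal.exp (-(l y : EReal))) y hy).trans hc1.le
    have h4 : ∀ y ∈ G, (-ENNReal.log c).toENNReal ≤ l y := fun y hy => by
      rw [← EReal.toENNReal_coe (x := l y)]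
      refine EReal.toENNReal_le_toENNReal ?_
      rw [EReal.neg_le, ← EReal.log_exp (-(l y : EReal))]
      exact ENNReal.log_monotone (h3 y hy)
    have h5 : ((-ENNReal.log c).toENNReal : EReal) ≤ ((⨅ y ∈ G, l y : ℝ≥0∞) : EReal) :=
      EReal.coe_ennreal_le_coe_ennreal_iff.2 (le_iInf₂ h4)
    have h6 := ((le_max_right _ _).trans_eq EReal.coe_toENNReal_eq_max.symm).trans h5
    rw [← ENNReal.exp_log c]
    refine EReal.exp_monotone ?_
    rw [EReal.neg_le]
    exact h6

theorem tendsto_lowerLambda_trunc (ht : ∀ α, 0 < t α) (h : C(X, ℝ)) :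
    Tendsto (fun M : ℝ => lowerLambda μ t (trunc h M)) atTop
      (𝓝 (⨆ M : ℝ, lowerLambda μ t (trunc h M))) :=
  tendsto_atTop_iSup fun _ _ hMN => lowerLambda_mono ht (trunc_monotone h hMN)

theorem limTruncLambda_eq (ht : ∀ α, 0 < t α) (h : C(X, ℝ)) :
    limTruncLambda μ t h = ⨆ M : ℝ, lowerLambda μ t (trunc h M) :=
  (tendsto_lowerLambda_trunc ht h).limUnder_eq

theorem limTruncLambda_le (ht : ∀ α, 0 < t α) (h : C(X, ℝ)) :
    limTruncLambda μ t h ≤ lowerLambda μ t (toEReal h) := by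
  rw [limTruncLambda_eq ht]
  exact iSup_le fun M => lowerLambda_mono ht (trunc_le h M)

/-- The lower half of the integral asymptotics, for truncated functions. -/
theorem sub_le_lowerLambda_trunc [OpensMeasurableSpace X] [IsDirectedOrder ι] [Nonempty ι]
    (ht : ∀ α, 0 < t α) (hL : LowerBounds μ t J) (h : C(X, ℝ)) {x : X} {M : ℝ} (hM : h x < M) :
    (h x : EReal) - J x ≤ lowerLambda μ t (trunc h M) := by
  have key : ∀ r : ℝ, r < h x → (r : EReal) - J x ≤ lowerLambda μ t (trunc h M) := by
    intro r hr
    have hG : IsOpen {y | r < h y ∧ h y < M} :=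
      (isOpen_lt continuous_const h.continuous).inter (isOpen_lt h.continuous continuous_const)
    set G := {y | r < h y ∧ h y < M}
    have hb : ∀ α, EReal.exp (r : EReal) * powMeasure μ t G α ≤ powIntegral μ t (trunc h M) α := by
      intro α
      rw [powMeasure, powIntegral, ← exp_div_rpow (ht α), ← ENNReal.mul_rpow_of_nonneg _ _ (ht α).le,
        ← lintegral_indicator_const hG.measurableSet]
      refine ENNReal.rpow_le_rpow (lintegral_mono fun y => ?_) (ht α).le
      by_cases hy : y ∈ G
      · rw [Set.indicator_of_mem hy, trunc, if_pos hy.2]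
        exact EReal.exp_monotone (EReal.div_le_div_right_of_nonneg (by exact_mod_cast (ht α).le)
          (by exact_mod_cast hy.1.le))
      · simp [hy]
    rw [lowerLambda, ← EReal.log_exp ((r : EReal) - J x)]
    refine ENNReal.log_monotone ?_
    calc EReal.exp ((r : EReal) - J x)
        = EReal.exp (r : EReal) * EReal.exp (-(J x : EReal)) := by rw [sub_eq_add_neg, EReal.exp_add]
      _ ≤ EReal.exp (r : EReal) * liminf (powMeasure μ t G) atTop := by
          gcongr
          exact (le_iSup₂ (f := fun y (_ : y ∈ G) => EReal.exp (-(J y : EReal))) x ⟨hr, hM⟩).trans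
            (hL G hG)
      _ = liminf (fun α => EReal.exp (r : EReal) * powMeasure μ t G α) atTop := by
          rw [ENNReal.liminf_const_mul_of_ne_top]
          simp
      _ ≤ _ := liminf_le_liminf (.of_forall hb)
  rcases eq_or_ne (J x) ⊤ with hJ | hJ
  · simp [hJ]
  lift J x to NNReal using hJ with j
  refine EReal.ge_of_forall_gt_iff_ge.1 fun z hz => ?_
  rw [EReal.coe_nnreal_eq_coe_real] at hz key
  have hz' : z < h x - j := by exact_mod_cast hz
  have := key (z + j) (by linarith)
  refine le_trans (le_of_eq ?_) this
  have : (z : ℝ) = (z + j) - j := by ring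
  exact_mod_cast this

/-- The truncated limit is the smallest of the functionals in play, so this one bound controls all
the suprema from above. -/
theorem sub_limTruncLambda_le [OpensMeasurableSpace X] [IsDirectedOrder ι] [Nonempty ι]
    (ht : ∀ α, 0 < t α) (hL : LowerBounds μ t J) (h : C(X, ℝ)) (x : X) :
    (h x : EReal) - limTruncLambda μ t h ≤ J x := by
  have h1 : (h x : EReal) - J x ≤ limTruncLambda μ t h := by
    rw [limTruncLambda_eq ht]
    exact (sub_le_lowerLambda_trunc ht hL h (lt_add_one (h x))).trans
      (le_iSup (fun M => lowerLambda μ t (trunc h M)) (h x + 1))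
  rcases eq_or_ne (J x) ⊤ with hJ | hJ
  · simp [hJ]
  have h2 := EReal.sub_le_iff_le_add (.inl (EReal.coe_ennreal_ne_bot _))
    (.inl (by simpa using hJ)) |>.1 h1
  refine EReal.sub_le_of_le_add ?_
  rwa [add_comm]

/-- The upper half of the integral asymptotics, for functions that are bounded above. -/
theorem upperLambda_le [OpensMeasurableSpace X] [∀ α, IsProbabilityMeasure (μ α)]
    [IsDirectedOrder ι] [Nonempty ι]
    (ht : ∀ α, 0 < t α) (ht0 : Tendsto t atTop (𝓝 0)) (hU : UpperBounds μ t J) {h : C(X, ℝ)}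
    (hh : BddAbove (Set.range (h : X → ℝ))) {s : ℝ} (hs : ∀ y, (h y : EReal) ≤ s + J y) :
    upperLambda μ t (toEReal h) ≤ s := by
  obtain ⟨B, hB⟩ := hh
  replace hB : ∀ y, h y ≤ B := fun y => hB ⟨y, rfl⟩
  have key : ∀ ε : ℝ, 0 < ε → upperLambda μ t (toEReal h) ≤ ((s + 3 * ε : ℝ) : EReal) := by
    intro ε hε
    -- `N` layers of height `ε` above level `s` reach past the bound `B`. On `F k` the hypothesis on
    -- `s` forces `J ≥ k * ε`. The final `3 * ε` collects the layer height, the slack in the upper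
    -- bound for `F k`, and the factor `(N + 1) ^ t α`, which tends to `1`.
    obtain ⟨N, hN⟩ := exists_nat_gt ((B - s) / ε)
    rw [div_lt_iff₀ hε] at hN
    let F : ℕ → Set X := fun k => {y | s + k * ε ≤ h y}
    have hF : ∀ k, IsClosed (F k) := fun k => isClosed_le continuous_const h.continuous
    have h1 : ∀ k : ℕ, ∀ᶠ α in atTop,
        powMeasure μ t (F k) α < EReal.exp ((-(k * ε) + ε : ℝ) : EReal) := by
      intro k
      refine eventually_lt_of_limsup_lt ?_
      refine (hU _ (hF k)).trans_lt (lt_of_le_of_lt (b := EReal.exp ((-(k * ε) : ℝ) : EReal)) ?_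
        (EReal.exp_strictMono (by exact_mod_cast (by linarith))))
      refine iSup₂_le fun y hy => EReal.exp_monotone ?_
      rw [EReal.coe_neg, EReal.neg_le_neg_iff]
      have hsy := hs y
      rcases eq_or_ne (J y) ⊤ with hJ | hJ
      · simp [hJ]
      lift J y to NNReal using hJ with j
      rw [EReal.coe_nnreal_eq_coe_real] at hsy ⊢
      have : h y ≤ s + j := by exact_mod_cast hsy
      have hy : s + k * ε ≤ h y := hy
      have : k * ε ≤ j := by linarith
      exact_mod_cast this
    have h2 : ∀ᶠ α in atTop, ((N + 1 : ℕ) : ℝ≥0∞) ^ t α < EReal.exp (ε : EReal) := by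
      have : Tendsto (fun α => ENNReal.ofReal (((N + 1 : ℕ) : ℝ) ^ t α)) atTop
          (𝓝 (ENNReal.ofReal (((N + 1 : ℕ) : ℝ) ^ (0 : ℝ)))) :=
        ENNReal.tendsto_ofReal (tendsto_const_nhds.rpow ht0 (.inl (by positivity)))
      have hlt : ENNReal.ofReal (((N + 1 : ℕ) : ℝ) ^ (0 : ℝ)) < EReal.exp (ε : EReal) := by
        rw [Real.rpow_zero, EReal.exp_coe]
        exact (ENNReal.ofReal_lt_ofReal_iff (Real.exp_pos _)).2 (Real.one_lt_exp_iff.2 hε)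
      filter_upwards [this.eventually_lt_const hlt] with α hα
      rwa [← ENNReal.ofReal_rpow_of_pos (by positivity), ENNReal.ofReal_natCast] at hα
    have h3 : ∀ᶠ α in atTop, ∀ k ∈ Finset.range N,
        powMeasure μ t (F k) α < EReal.exp ((-(k * ε) + ε : ℝ) : EReal) :=
      (Filter.eventually_all_finset _).2 fun k _ => h1 k
    rw [upperLambda, ← EReal.log_exp ((s + 3 * ε : ℝ) : EReal)]
    refine ENNReal.log_monotone (limsup_le_of_le (by isBoundedDefault) ?_)
    filter_upwards [h2, h3] with α hα2 hα3
    have e : ∀ r : ℝ, EReal.exp ((r : EReal) / (t α : EReal)) = ENNReal.ofReal (Real.exp (r / t α)) :=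
      fun r => by rw [← EReal.coe_div, EReal.exp_coe]
    have hpt : ∀ y, EReal.exp (toEReal h y / (t α : EReal)) ≤
        EReal.exp ((s : EReal) / (t α : EReal)) + ∑ k ∈ Finset.range N,
          (F k).indicator (fun _ =>
            EReal.exp (((s + (k + 1) * ε : ℝ) : EReal) / (t α : EReal))) y := by
      intro y
      have htα : (0 : EReal) ≤ t α := by exact_mod_cast (ht α).le
      rcases le_total (h y) s with hy | hy
      · exact le_add_right (EReal.exp_monotone (EReal.div_le_div_right_of_nonneg htα
          (by unfold toEReal; exact_mod_cast hy)))
      · set k := ⌊(h y - s) / ε⌋₊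
        have hk1 : k * ε ≤ h y - s := by
          rw [← le_div_iff₀ hε]
          exact Nat.floor_le (div_nonneg (by linarith) hε.le)
        have hk2 : h y - s < (k + 1) * ε := by
          rw [← div_lt_iff₀ hε]
          exact Nat.lt_floor_add_one _
        have hkN : k ∈ Finset.range N := by
          rw [Finset.mem_range]
          have : (k : ℝ) * ε < N * ε := by linarith [hB y]
          exact_mod_cast lt_of_mul_lt_mul_right this hε.le
        have hyk : y ∈ F k := show s + k * ε ≤ h y by linarith
        refine le_add_left (le_trans ?_ (Finset.single_le_sum (f := fun k => (F k).indicator (fun _ =>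
            EReal.exp (((s + (k + 1) * ε : ℝ) : EReal) / (t α : EReal))) y)
            (fun _ _ => zero_le) hkN))
        simp only [Set.indicator_of_mem hyk]
        refine EReal.exp_monotone (EReal.div_le_div_right_of_nonneg htα ?_)
        unfold toEReal
        exact_mod_cast (by linarith : h y ≤ s + (k + 1) * ε)
    have hterm : ∀ k ∈ Finset.range N,
        EReal.exp (((s + (k + 1) * ε : ℝ) : EReal) / (t α : EReal)) * μ α (F k) ≤
          EReal.exp (((s + 2 * ε : ℝ) : EReal) / (t α : EReal)) := by
      intro k hk
      rw [← ENNReal.rpow_le_rpow_iff (ht α), ENNReal.mul_rpow_of_nonneg _ _ (ht α).le,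
        exp_div_rpow (ht α), exp_div_rpow (ht α)]
      refine (mul_le_mul_right (hα3 k hk).le _).trans (le_of_eq ?_)
      rw [← EReal.exp_add, ← EReal.coe_add]
      congr 2
      ring
    have hint : ∫⁻ y, EReal.exp (toEReal h y / (t α : EReal)) ∂(μ α) ≤
        ((N + 1 : ℕ) : ℝ≥0∞) * EReal.exp (((s + 2 * ε : ℝ) : EReal) / (t α : EReal)) := by
      refine (lintegral_mono hpt).trans ?_
      rw [lintegral_add_left measurable_const, lintegral_const, measure_univ, mul_one,
        lintegral_finsetSum _ fun k _ => measurable_const.indicator (hF k).measurableSet]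
      simp_rw [lintegral_indicator_const (hF _).measurableSet]
      refine (add_le_add (EReal.exp_monotone (EReal.div_le_div_right_of_nonneg
        (by exact_mod_cast (ht α).le)
        (EReal.coe_le_coe_iff.2 (by linarith : s ≤ s + 2 * ε))))
        (Finset.sum_le_sum hterm)).trans (le_of_eq ?_)
      rw [Finset.sum_const, Finset.card_range, nsmul_eq_mul, Nat.cast_add_one]
      ring
    calc powIntegral μ t (toEReal h) α
        ≤ (((N + 1 : ℕ) : ℝ≥0∞) * EReal.exp (((s + 2 * ε : ℝ) : EReal) / (t α : EReal))) ^ t α :=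
          ENNReal.rpow_le_rpow hint (ht α).le
      _ = ((N + 1 : ℕ) : ℝ≥0∞) ^ t α * EReal.exp ((s + 2 * ε : ℝ) : EReal) := by
          rw [ENNReal.mul_rpow_of_nonneg _ _ (ht α).le, exp_div_rpow (ht α)]
      _ ≤ EReal.exp (ε : EReal) * EReal.exp ((s + 2 * ε : ℝ) : EReal) := by gcongr
      _ = EReal.exp ((s + 3 * ε : ℝ) : EReal) := by
          rw [← EReal.exp_add, ← EReal.coe_add]
          congr 2
          ring
  refine EReal.le_of_forall_lt_iff_le.1 fun z hz => ?_
  have hz' : s < z := by exact_mod_cast hz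
  have := key ((z - s) / 3) (by linarith)
  rwa [show s + 3 * ((z - s) / 3) = z by ring] at this

/-- Varadhan's limit exists for continuous functions that are bounded above. -/
theorem tendsto_powIntegral [OpensMeasurableSpace X] [∀ α, IsProbabilityMeasure (μ α)]
    [IsDirectedOrder ι] [Nonempty ι]
    (ht : ∀ α, 0 < t α) (ht0 : Tendsto t atTop (𝓝 0)) (hU : UpperBounds μ t J)
    (hL : LowerBounds μ t J) {h : C(X, ℝ)} (hh : BddAbove (Set.range (h : X → ℝ))) :
    Tendsto (powIntegral μ t (toEReal h)) atTop (𝓝 (limsup (powIntegral μ t (toEReal h)) atTop)) := by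
  refine tendsto_of_le_liminf_of_limsup_le ?_ le_rfl
  rw [← ENNReal.log_le_log_iff]
  change upperLambda μ t _ ≤ lowerLambda μ t _
  -- Any real `s` above `lowerLambda h` satisfies `h ≤ s + J` by the lower half, so the upper half
  -- applies to it.
  refine EReal.le_of_forall_lt_iff_le.1 fun s hs => upperLambda_le ht ht0 hU hh fun y => ?_
  have h1 := (sub_le_lowerLambda_trunc ht hL h (lt_add_one (h y))).trans
    (lowerLambda_mono ht (trunc_le h (h y + 1)))
  exact EReal.sub_le_iff_le_add (.inl (EReal.coe_ennreal_ne_bot _)) (.inr (EReal.coe_ne_bot _)) |>.1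
    (h1.trans hs.le)

theorem Lambda_eq_upperLambda [OpensMeasurableSpace X] [∀ α, IsProbabilityMeasure (μ α)]
    [IsDirectedOrder ι] [Nonempty ι]
    (ht : ∀ α, 0 < t α) (ht0 : Tendsto t atTop (𝓝 0)) (hU : UpperBounds μ t J)
    (hL : LowerBounds μ t J) {h : C(X, ℝ)} (hh : BddAbove (Set.range (h : X → ℝ))) :
    Lambda μ t (toEReal h) = upperLambda μ t (toEReal h) := by
  rw [Lambda, (tendsto_powIntegral ht ht0 hU hL hh).limUnder_eq, upperLambda]

/-- A criterion for a class of functions that are bounded above to recover the rate function. -/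
theorem le_iSup_sub_upperLambda [OpensMeasurableSpace X] [∀ α, IsProbabilityMeasure (μ α)]
    [IsDirectedOrder ι] [Nonempty ι]
    (ht : ∀ α, 0 < t α) (ht0 : Tendsto t atTop (𝓝 0)) (hU : UpperBounds μ t J)
    {B : Set C(X, ℝ)} (hB : ∀ h ∈ B, BddAbove (Set.range (h : X → ℝ))) (h0 : 0 ∈ B) (x : X)
    (hc : ∀ c : ℝ, 0 ≤ c → (c : EReal) < J x → ∀ δ : ℝ, 0 < δ →
      ∃ h ∈ B, ∃ s : ℝ, (∀ y, (h y : EReal) ≤ s + J y) ∧ c - δ ≤ h x - s) :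
    (J x : EReal) ≤ ⨆ h ∈ B, ((h x : EReal) - upperLambda μ t (toEReal h)) := by
  have key : ∀ h ∈ B, ∀ s : ℝ, (∀ y, (h y : EReal) ≤ s + J y) →
      ((h x - s : ℝ) : EReal) ≤ ⨆ h ∈ B, ((h x : EReal) - upperLambda μ t (toEReal h)) := by
    intro h hh s hs
    refine le_trans ?_ (le_iSup₂ (f := fun (h : C(X, ℝ)) (_ : h ∈ B) =>
      (h x : EReal) - upperLambda μ t (toEReal h)) h hh)
    rw [EReal.coe_sub]
    exact EReal.sub_le_sub le_rfl (upperLambda_le ht ht0 hU (hB h hh) hs)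
  refine EReal.ge_of_forall_gt_iff_ge.1 fun z hz => ?_
  rcases lt_or_ge z 0 with hz0 | hz0
  -- Negative levels are covered by the zero function with `s = 0`.
  · refine le_trans ?_ (key 0 h0 0 fun y => by simpa using EReal.coe_ennreal_nonneg _)
    simpa using hz0.le
  · refine EReal.ge_of_forall_gt_iff_ge.1 fun w hw => ?_
    have hw' : w < z := by exact_mod_cast hw
    obtain ⟨h, hh, s, hs, hd⟩ := hc z hz0 hz (z - w) (by linarith)
    refine le_trans ?_ (key h hh s hs)
    exact_mod_cast (by linarith : w ≤ h x - s)

/-- All the suprema over a class lie between the rate function and the supremum over any subclass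
that recovers it. -/
theorem rate_eq_iSup [OpensMeasurableSpace X] [IsDirectedOrder ι] [Nonempty ι]
    (ht : ∀ α, 0 < t α) (hL : LowerBounds μ t J) {A B : Set C(X, ℝ)} (hBA : B ⊆ A) (x : X)
    (hB : (J x : EReal) ≤ ⨆ h ∈ B, ((h x : EReal) - upperLambda μ t (toEReal h)))
    {V : C(X, ℝ) → EReal} (hV1 : ∀ h, limTruncLambda μ t h ≤ V h)
    (hV2 : ∀ h, V h ≤ upperLambda μ t (toEReal h)) :
    (J x : EReal) = ⨆ h ∈ A, ((h x : EReal) - V h) := by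
  refine le_antisymm (hB.trans ?_) (iSup₂_le fun h _ =>
    (EReal.sub_le_sub le_rfl (hV1 h)).trans (sub_limTruncLambda_le ht hL h x))
  exact (biSup_mono hBA).trans (iSup₂_mono fun h _ => EReal.sub_le_sub le_rfl (hV2 h))

end Bounds


/-! ### Separation and approximation on compact sets -/

section Separation

variable {X : Type*} [TopologicalSpace X]

/-- Needed so that compact sets are closed and the lower bound applies to their complements. -/
theorem t2Space_of_separating {A : Set C(X, ℝ)}
    (hA : IsSeparatingAlgebra A ∨ IsWellSeparating A) : T2Space X := by
  have hsep : ∀ x y : X, x ≠ y → ∃ h : C(X, ℝ), h x ≠ h y := by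
    intro x y hxy
    rcases hA with hA | hA
    · obtain ⟨h, -, hh⟩ := hA.2 x y hxy
      exact ⟨h, hh⟩
    · obtain ⟨h, -, h1, h2⟩ := hA.2.2 x y hxy 0 1
      exact ⟨h, by simp [h1, h2]⟩
  refine ⟨fun x y hxy => ?_⟩
  obtain ⟨h, hh⟩ := hsep x y hxy
  exact separated_by_continuous h.continuous hh

/-- Each point of `K` has a neighbourhood handled by one separating function cut off at `0`;
compactness leaves finitely many, and their minimum works. -/
theorem IsWellSeparating.exists_mem_le {A : Set C(X, ℝ)} (hA : IsWellSeparating A) {K : Set X}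
    (hK : IsCompact K) {x : X} (hx : x ∉ K) (c : ℝ) :
    ∃ h ∈ A, (∀ y, h y ≤ 0) ∧ h x = 0 ∧ ∀ y ∈ K, h y ≤ c := by
  refine hK.induction_on (p := fun K => ∃ h ∈ A, (∀ y, h y ≤ 0) ∧ h x = 0 ∧ ∀ y ∈ K, h y ≤ c)
    ?_ ?_ ?_ ?_
  · exact ⟨_, hA.1 0, fun _ => le_rfl, rfl, by simp⟩
  · rintro s u hsu ⟨h, hh, h1, h2, h3⟩
    exact ⟨h, hh, h1, h2, fun y hy => h3 y (hsu hy)⟩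
  · rintro s u ⟨h, hh, h1, h2, h3⟩ ⟨g, hg, g1, g2, g3⟩
    refine ⟨h ⊓ g, hA.2.1 h hh g hg, fun y => inf_le_left.trans (h1 y), by simp [h2, g2], ?_⟩
    rintro y (hy | hy)
    · exact inf_le_left.trans (h3 y hy)
    · exact inf_le_right.trans (g3 y hy)
  · intro y hy
    obtain ⟨h, hh, h1, h2⟩ := hA.2.2 x y (fun e => hx (e ▸ hy)) 0 (c - 1)
    refine ⟨{z | h z < c}, mem_nhdsWithin_of_mem_nhds
      ((isOpen_lt h.continuous continuous_const).mem_nhds (by simp [h2])), h ⊓ .const X 0,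
      hA.2.1 h hh _ (hA.1 0), fun z => inf_le_right, by simp [h1], fun z hz => ?_⟩
    exact inf_le_left.trans (le_of_lt hz)

/-- Up to constants, a separating algebra is dense for uniform convergence on compact sets. -/
theorem exists_add_const_near (S : NonUnitalSubalgebra ℝ C(X, ℝ))
    (hS : ∀ x y : X, x ≠ y → ∃ h ∈ S, h x ≠ h y) {K : Set X} (hK : IsCompact K) (φ : C(X, ℝ))
    {δ : ℝ} (hδ : 0 < δ) : ∃ a ∈ S, ∃ r : ℝ, ∀ y ∈ K, |a y + r - φ y| < δ := by
  have : CompactSpace K := isCompact_iff_compactSpace.1 hK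
  -- Restrictions to `K` of elements of `S` plus constants: a unital algebra, to which
  -- Stone–Weierstrass applies.
  let T : Subalgebra ℝ C(K, ℝ) :=
    { carrier := {f | ∃ a ∈ S, ∃ r : ℝ, ∀ y : K, f y = a y + r}
      mul_mem' := by
        rintro f g ⟨a, ha, r, hf⟩ ⟨b, hb, q, hg⟩
        refine ⟨a * b + q • a + r • b, S.add_mem (S.add_mem (S.mul_mem ha hb) (S.smul_mem q ha))
          (S.smul_mem r hb), r * q, fun y => ?_⟩
        simp only [ContinuousMap.mul_apply, ContinuousMap.add_apply, ContinuousMap.smul_apply,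
          smul_eq_mul, hf, hg]
        ring
      add_mem' := by
        rintro f g ⟨a, ha, r, hf⟩ ⟨b, hb, q, hg⟩
        refine ⟨a + b, S.add_mem ha hb, r + q, fun y => ?_⟩
        simp only [ContinuousMap.add_apply, hf, hg]
        ring
      algebraMap_mem' := fun r => ⟨0, S.zero_mem, r, fun y => by simp⟩ }
  have hT : T.SeparatesPoints := by
    intro x y hxy
    obtain ⟨h, hh, hne⟩ := hS x y (fun e => hxy (Subtype.ext e))
    exact ⟨_, ⟨h.restrict K, ⟨h, hh, 0, fun y => by simp⟩, rfl⟩, by simpa using hne⟩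
  obtain ⟨⟨g, a, ha, r, hg⟩, hgφ⟩ :=
    ContinuousMap.exists_mem_subalgebra_near_continuous_of_separatesPoints T hT
      (fun y : K => φ y) (φ.continuous.comp continuous_subtype_val) δ hδ
  refine ⟨a, ha, r, fun y hy => ?_⟩
  have := hgφ ⟨y, hy⟩
  rwa [Real.norm_eq_abs, hg] at this

/-- If `u` belongs to a separating algebra and `φ = u * ψ` on a compact set, then `φ` is a uniform
limit of elements of the algebra on that set. -/
theorem exists_mem_near_mul (S : NonUnitalSubalgebra ℝ C(X, ℝ))
    (hS : ∀ x y : X, x ≠ y → ∃ h ∈ S, h x ≠ h y) {K : Set X} (hK : IsCompact K) {u : C(X, ℝ)}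
    (hu : u ∈ S) (ψ : C(X, ℝ)) {δ : ℝ} (hδ : 0 < δ) :
    ∃ f ∈ S, ∀ y ∈ K, |f y - u y * ψ y| < δ := by
  obtain ⟨C, hC⟩ := hK.exists_bound_of_continuousOn u.continuous.continuousOn
  have hC1 : 0 < max C 1 := lt_max_of_lt_right one_pos
  obtain ⟨a, ha, r, har⟩ := exists_add_const_near S hS hK ψ (div_pos hδ hC1)
  -- Multiplying by `u` absorbs the constant: `u * (a + r)` lies in `S` although `a + r` need not.
  refine ⟨u * a + r • u, S.add_mem (S.mul_mem hu ha) (S.smul_mem r hu), fun y hy => ?_⟩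
  have h1 : (u * a + r • u) y - u y * ψ y = u y * (a y + r - ψ y) := by
    simp only [ContinuousMap.mul_apply, ContinuousMap.add_apply, ContinuousMap.smul_apply,
      smul_eq_mul]
    ring
  have h2 : |u y| ≤ max C 1 := (hC y hy).trans (le_max_left _ _)
  have h3 := har y hy
  rw [lt_div_iff₀ hC1] at h3
  rw [h1, abs_mul]
  nlinarith [abs_nonneg (a y + r - ψ y)]

/-- An algebra that vanishes nowhere has an element that is positive on a given compact set. -/
theorem exists_mem_pos (S : NonUnitalSubalgebra ℝ C(X, ℝ)) {K : Set X} (hK : IsCompact K)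
    (hS : ∀ x ∈ K, ∃ h ∈ S, h x ≠ 0) :
    ∃ u ∈ S, (∀ y, 0 ≤ u y) ∧ ∀ y ∈ K, 0 < u y := by
  refine hK.induction_on (p := fun K => ∃ u ∈ S, (∀ y, 0 ≤ u y) ∧ ∀ y ∈ K, 0 < u y) ?_ ?_ ?_ ?_
  · exact ⟨0, S.zero_mem, fun _ => le_rfl, by simp⟩
  · rintro s v hsv ⟨u, hu, h1, h2⟩
    exact ⟨u, hu, h1, fun y hy => h2 y (hsv hy)⟩
  · rintro s v ⟨u, hu, h1, h2⟩ ⟨w, hw, g1, g2⟩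
    refine ⟨u + w, S.add_mem hu hw, fun y => add_nonneg (h1 y) (g1 y), ?_⟩
    rintro y (hy | hy)
    · exact add_pos_of_pos_of_nonneg (h2 y hy) (g1 y)
    · exact add_pos_of_nonneg_of_pos (h1 y) (g2 y hy)
  · intro y hy
    obtain ⟨h, hh, hne⟩ := hS y hy
    exact ⟨{z | h z ≠ 0}, mem_nhdsWithin_of_mem_nhds
      ((isOpen_ne_fun h.continuous continuous_const).mem_nhds hne), h * h, S.mul_mem hh hh,
      fun z => mul_self_nonneg (h z), fun z hz => mul_self_pos.2 hz⟩

/-- An algebra that separates points and vanishes nowhere is dense for uniform convergence on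
compact sets. -/
theorem exists_mem_near (S : NonUnitalSubalgebra ℝ C(X, ℝ))
    (hS : ∀ x y : X, x ≠ y → ∃ h ∈ S, h x ≠ h y) {K : Set X} (hK : IsCompact K)
    (hS0 : ∀ x ∈ K, ∃ h ∈ S, h x ≠ 0) (φ : C(X, ℝ)) {δ : ℝ} (hδ : 0 < δ) :
    ∃ f ∈ S, ∀ y ∈ K, |f y - φ y| < δ := by
  obtain ⟨u, hu, -, hpos⟩ := exists_mem_pos S hK hS0
  obtain ⟨m, hm, hmu⟩ : ∃ m : ℝ, 0 < m ∧ ∀ y ∈ K, m ≤ u y := by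
    rcases K.eq_empty_or_nonempty with rfl | hne
    · exact ⟨1, one_pos, by simp⟩
    · obtain ⟨z, hz, hzm⟩ := hK.exists_isMinOn hne u.continuous.continuousOn
      exact ⟨u z, hpos z hz, fun y hy => hzm hy⟩
  -- `max u m` equals `u` on `K` and never vanishes, so the quotient of `φ` by it is continuous on
  -- all of `X`.
  have hmax : ∀ y, max (u y) m ≠ 0 := fun y => (lt_max_of_lt_right hm).ne'
  obtain ⟨f, hf, hfu⟩ := exists_mem_near_mul S hS hK hu
    ⟨fun y => φ y / max (u y) m, φ.continuous.div (u.continuous.max continuous_const) hmax⟩ hδ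
  refine ⟨f, hf, fun y hy => ?_⟩
  have h1 : |f y - u y * (φ y / max (u y) m)| < δ := hfu y hy
  rwa [max_eq_left (hmu y hy), mul_div_cancel₀ _ (hpos y hy).ne'] at h1

/-- Urysohn functions in completely regular spaces. -/
theorem exists_continuousMap_bump [CompletelyRegularSpace X] {G : Set X} (hG : IsOpen G) {x : X}
    (hx : x ∈ G) :
    ∃ φ : C(X, ℝ), φ x = 0 ∧ (∀ y, 0 ≤ φ y) ∧ ∀ y ∉ G, φ y = 1 := by
  obtain ⟨f, hf, hfx, hfG⟩ := CompletelyRegularSpace.completely_regular x Gᶜ hG.isClosed_compl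
    (by simpa using hx)
  exact ⟨⟨fun y => (f y : ℝ), continuous_subtype_val.comp hf⟩, by simp [hfx], fun y => (f y).2.1,
    fun y hy => by simp [hfG hy]⟩

end Separation

/-- The lower bound on the open set `Kᶜ` gives `e^{-J y} ≤ liminf μ^t(Kᶜ) ≤ e^{-c}` for `y ∉ K`. -/
theorem ExponentiallyTight.exists_isCompact {X ι : Type*} [TopologicalSpace X]
    [MeasurableSpace X] [Preorder ι] {μ : ι → Measure X} {t : ι → ℝ} {J : X → ℝ≥0∞} [T2Space X] [IsDirectedOrder ι] [Nonempty ι]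
    (hT : ExponentiallyTight μ t) (hL : LowerBounds μ t J) (c : ℝ) :
    ∃ K : Set X, IsCompact K ∧ ∀ y ∉ K, (c : EReal) ≤ J y := by
  obtain ⟨K, hK, hlt⟩ := hT (EReal.exp ((-c : ℝ) : EReal)) (by simp [EReal.exp_coe, Real.exp_pos, -EReal.coe_neg])
  refine ⟨K, hK, fun y hy => ?_⟩
  have h1 : EReal.exp (-(J y : EReal)) ≤ EReal.exp ((-c : ℝ) : EReal) :=
    (le_iSup₂ (f := fun y (_ : y ∈ Kᶜ) => EReal.exp (-(J y : EReal))) y hy).trans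
      ((hL _ hK.isClosed.isOpen_compl).trans ((liminf_le_limsup (by isBoundedDefault) (by isBoundedDefault)).trans hlt.le))
  rwa [EReal.exp_le_exp_iff, EReal.coe_neg, EReal.neg_le_neg_iff] at h1

theorem coe_le_add_rate {X : Type*} {J : X → ℝ≥0∞} {a s c : ℝ} {y : X} (hy : (c : EReal) ≤ J y) (h : a ≤ s + c) :
    (a : EReal) ≤ s + J y :=
  calc (a : EReal) ≤ ((s + c : ℝ) : EReal) := by exact_mod_cast h
    _ = s + c := EReal.coe_add s c
    _ ≤ s + J y := by gcongr

theorem coe_le_add_rate_of_le {X : Type*} {J : X → ℝ≥0∞} {a s : ℝ} {y : X} (h : a ≤ s) : (a : EReal) ≤ s + J y :=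
  coe_le_add_rate (c := 0) (by simpa using EReal.coe_ennreal_nonneg _) (by simpa using h)

/-! ### Test functions recovering the rate at a point -/

section Recovery

variable {X : Type*} [TopologicalSpace X] {J : X → ℝ≥0∞}

theorem isOpen_lt_rate (hJ : LowerSemicontinuous J) (c : ℝ) :
    IsOpen {y | (c : EReal) < J y} :=
  (continuous_coe_ennreal_ereal.comp_lowerSemicontinuous hJ
    EReal.coe_ennreal_strictMono.monotone).isOpen_preimage (c : EReal)

theorem exists_negPart_univ [CompletelyRegularSpace X] (hJ : LowerSemicontinuous J) {x : X} {c : ℝ}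
    (hc : 0 ≤ c) (hx : (c : EReal) < J x) :
    ∃ h ∈ negPart (Set.univ : Set C(X, ℝ)), ∃ s : ℝ,
      (∀ y, (h y : EReal) ≤ s + J y) ∧ c ≤ h x - s := by
  obtain ⟨φ, h1, h2, h4⟩ := exists_continuousMap_bump (isOpen_lt_rate hJ c) hx
  -- With `s = -c`, the bound `s + J` is nonnegative where `J > c`; elsewhere `φ = 1` and `h = -c =
  -- s`.
  refine ⟨-(c • φ), ⟨trivial, fun y => ?_⟩, -c, fun y => ?_, by simp [h1]⟩
  · simpa using mul_nonneg hc (h2 y)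
  · by_cases hy : (c : EReal) < J y
    · exact coe_le_add_rate hy.le (by simpa using mul_nonneg hc (h2 y))
    · exact coe_le_add_rate_of_le (by simp [h4 y hy])

theorem IsWellSeparating.exists_negPart {A : Set C(X, ℝ)} (hA : IsWellSeparating A)
    (hJ : LowerSemicontinuous J) {K : Set X} {x : X} {c : ℝ} (hK : IsCompact K)
    (hKc : ∀ y ∉ K, (c : EReal) ≤ J y) (hx : (c : EReal) < J x) :
    ∃ h ∈ negPart A, ∃ s : ℝ, (∀ y, (h y : EReal) ≤ s + J y) ∧ c ≤ h x - s := by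
  -- The compact set `K ∩ {J ≤ c}` misses `x` and contains every point with `J < c`, the only ones
  -- where `h ≤ 0` is not enough.
  obtain ⟨h, hh, h1, h2, h3⟩ := hA.exists_mem_le (hK.diff (isOpen_lt_rate hJ c)) (x := x)
    (fun h => h.2 hx) (-c)
  refine ⟨h, ⟨hh, h1⟩, -c, fun y => ?_, by simp [h2]⟩
  by_cases hy : (c : EReal) ≤ J y
  · exact coe_le_add_rate hy (by simpa using h1 y)
  · exact coe_le_add_rate_of_le (h3 y ⟨not_imp_comm.1 (hKc y) hy, fun h => hy (le_of_lt h)⟩)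

/-- An element of an algebra that is small at `x` and close to `1` where the rate is at most `c`
recovers the rate function through its negated square. -/
theorem exists_negPart_of_near_zero {S : NonUnitalSubalgebra ℝ C(X, ℝ)} {x : X} {c δ : ℝ}
    (hc : 0 ≤ c) (hδ : 0 ≤ δ) {f : C(X, ℝ)} (hf : f ∈ S) (hfx : |f x| ≤ δ)
    (hfy : ∀ y, ¬ (c : EReal) ≤ J y → 1 - δ ≤ f y ) (hδ1 : δ ≤ 1) :
    ∃ h ∈ negPart (S : Set C(X, ℝ)), ∃ s : ℝ,
      (∀ y, (h y : EReal) ≤ s + J y) ∧ c - 3 * c * δ ≤ h x - s := by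
  -- Squaring gives the sign globally, whatever `f` does off the compact set; `s` is the largest
  -- value of `-c f²` allowed by `f ≥ 1 - δ`.
  refine ⟨(-c) • (f * f), ⟨S.smul_mem _ (S.mul_mem hf hf), fun y => ?_⟩, -c * (1 - δ) ^ 2,
    fun y => ?_, ?_⟩
  · simpa using mul_nonneg hc (mul_self_nonneg (f y))
  · by_cases hy : (c : EReal) ≤ J y
    · refine coe_le_add_rate hy ?_
      have h1 : 0 ≤ c * (f y * f y) := mul_nonneg hc (mul_self_nonneg (f y))
      have h2 : 0 ≤ c * (δ * (2 - δ)) := mul_nonneg hc (mul_nonneg hδ (by linarith))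
      simp only [ContinuousMap.smul_apply, ContinuousMap.mul_apply, smul_eq_mul]
      nlinarith
    · refine coe_le_add_rate_of_le ?_
      have h1 := mul_le_mul_of_nonneg_left
        (pow_le_pow_left₀ (by linarith : 0 ≤ 1 - δ) (hfy y hy) 2) hc
      simp only [ContinuousMap.smul_apply, ContinuousMap.mul_apply, smul_eq_mul]
      nlinarith
  · have h1 : f x * f x ≤ δ * δ := by
      rw [← abs_mul_abs_self (f x)]
      exact mul_le_mul hfx hfx (abs_nonneg _) hδ
    have h2 := mul_le_mul_of_nonneg_left h1 hc
    have h3 : c * (δ * δ) ≤ c * δ :=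
      mul_le_mul_of_nonneg_left (mul_le_of_le_one_left hδ hδ1) hc
    simp only [ContinuousMap.smul_apply, ContinuousMap.mul_apply, smul_eq_mul]
    nlinarith

/-- An element of an algebra that is close to `1` at `x` and small where the rate is at most `c`
recovers the rate function. -/
theorem exists_bddAbovePart_of_near_one {S : NonUnitalSubalgebra ℝ C(X, ℝ)} {x : X} {c δ : ℝ}
    (hc : 0 ≤ c) (hδ : 0 ≤ δ) {f : C(X, ℝ)} (hf : f ∈ S) (hfx : |f x - 1| ≤ δ)
    (hfy : ∀ y, ¬ (c : EReal) ≤ J y → f y ≤ δ) (hδ1 : δ ≤ 1) :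
    ∃ h ∈ bddAbovePart (S : Set C(X, ℝ)), ∃ s : ℝ,
      (∀ y, (h y : EReal) ≤ s + J y) ∧ c - 3 * c * δ ≤ h x - s := by
  have hle : ∀ y, c * (2 * f y - f y * f y) ≤ c := fun y => by
    nlinarith [mul_nonneg hc (mul_self_nonneg (f y - 1))]
  have heq : ∀ y, (c • ((2 : ℝ) • f - f * f)) y = c * (2 * f y - f y * f y) := fun y => by simp
  -- Since `2f - f² = 1 - (1 - f)²`, this is at most `c` everywhere and nearly `c` at `x`; where `f
  -- ≤ δ` it is at most `2cδ`, which is `s`.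
  refine ⟨c • ((2 : ℝ) • f - f * f), ⟨S.smul_mem _ (S.sub_mem (S.smul_mem _ hf) (S.mul_mem hf hf)),
    c, Set.forall_mem_range.2 fun y => heq y ▸ hle y⟩, 2 * c * δ, fun y => ?_, ?_⟩
  · by_cases hy : (c : EReal) ≤ J y
    · refine coe_le_add_rate hy ?_
      rw [heq]
      have := mul_nonneg hc hδ
      linarith [hle y]
    · refine coe_le_add_rate_of_le ?_
      rw [heq]
      nlinarith [mul_nonneg hc (mul_self_nonneg (f y)), mul_le_mul_of_nonneg_left (hfy y hy) hc]
  · rw [heq]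
    have h1 : (f x - 1) * (f x - 1) ≤ δ * δ := by
      rw [← abs_mul_abs_self (f x - 1)]
      exact mul_le_mul hfx hfx (abs_nonneg _) hδ
    have h2 := mul_le_mul_of_nonneg_left h1 hc
    have h3 : c * (δ * δ) ≤ c * δ :=
      mul_le_mul_of_nonneg_left (mul_le_of_le_one_left hδ hδ1) hc
    nlinarith

/-- A tolerance `η ≤ 1` with `3 * c * η ≤ δ`. -/
theorem exists_tolerance {c δ : ℝ} (hc : 0 ≤ c) (hδ : 0 < δ) :
    ∃ η : ℝ, 0 < η ∧ η ≤ 1 ∧ 3 * c * η ≤ δ := by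
  refine ⟨min 1 (δ / (3 * c + 1)), by positivity, min_le_left _ _, ?_⟩
  have h1 : min 1 (δ / (3 * c + 1)) ≤ δ / (3 * c + 1) := min_le_right _ _
  rw [le_div_iff₀ (by positivity)] at h1
  have h2 : 0 ≤ min 1 (δ / (3 * c + 1)) := by positivity
  nlinarith

theorem exists_negPart_of_vanishesNowhere [CompletelyRegularSpace X]
    {S : NonUnitalSubalgebra ℝ C(X, ℝ)} (hS : ∀ x y : X, x ≠ y → ∃ h ∈ S, h x ≠ h y)
    (hS0 : ∀ x : X, ∃ h ∈ S, h x ≠ 0)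
    (hJ : LowerSemicontinuous J) {K : Set X} {x : X} {c δ : ℝ} (hc : 0 ≤ c) (hδ : 0 < δ)
    (hK : IsCompact K) (hKc : ∀ y ∉ K, (c : EReal) ≤ J y) (hx : (c : EReal) < J x) :
    ∃ h ∈ negPart (S : Set C(X, ℝ)), ∃ s : ℝ,
      (∀ y, (h y : EReal) ≤ s + J y) ∧ c - δ ≤ h x - s := by
  obtain ⟨η, hη, hη1, hηδ⟩ := exists_tolerance hc hδ
  obtain ⟨φ, h1, -, h4⟩ := exists_continuousMap_bump (isOpen_lt_rate hJ c) hx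
  obtain ⟨f, hf, hfφ⟩ := exists_mem_near S hS (hK.insert x) (fun y _ => hS0 y) φ hη
  obtain ⟨h, hh, s, hs, hxs⟩ := exists_negPart_of_near_zero (J := J) (x := x) hc hη.le hf
    (by simpa [h1] using (hfφ x (Set.mem_insert x K)).le)
    (fun y hy => by
      have := (abs_lt.1 (hfφ y (Set.mem_insert_of_mem x (not_imp_comm.1 (hKc y) hy)))).1
      rw [h4 y fun h => hy (le_of_lt h)] at this
      linarith) hη1
  exact ⟨h, hh, s, hs, by linarith⟩

/-- Without nonvanishing, nonpositive functions may fail: if `S` vanishes at a zero of `J`, every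
nonpositive `h` in `S` has `Λ(h) = 0`. A positive peak at `x` is used instead, available when some
`v` in `S` has `v x ≠ 0`. -/
theorem exists_bddAbovePart_of_separating [CompletelyRegularSpace X]
    {S : NonUnitalSubalgebra ℝ C(X, ℝ)} (hS : ∀ x y : X, x ≠ y → ∃ h ∈ S, h x ≠ h y)
    (hJ : LowerSemicontinuous J) {K : Set X} {x : X} {c δ : ℝ} (hc : 0 ≤ c) (hδ : 0 < δ)
    (hK : IsCompact K) (hKc : ∀ y ∉ K, (c : EReal) ≤ J y) (hx : (c : EReal) < J x) :
    ∃ h ∈ bddAbovePart (S : Set C(X, ℝ)), ∃ s : ℝ,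
      (∀ y, (h y : EReal) ≤ s + J y) ∧ c - δ ≤ h x - s := by
  obtain ⟨η, hη, hη1, hηδ⟩ := exists_tolerance hc hδ
  by_cases hx0 : ∃ v ∈ S, v x ≠ 0
  · obtain ⟨v, hv, hvx⟩ := hx0
    let u : C(X, ℝ) := (v x)⁻¹ • v
    have hux : u x = 1 := by simp [u, hvx]
    obtain ⟨φ, h1, -, h4⟩ := exists_continuousMap_bump
      ((isOpen_lt_rate hJ c).inter (isOpen_lt continuous_const u.continuous : IsOpen {y | 1 / 2 < u y}))
      (x := x) ⟨hx, by norm_num [hux]⟩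
    obtain ⟨f, hf, hfφ⟩ := exists_mem_near_mul S hS (hK.insert x) (S.smul_mem (v x)⁻¹ hv)
      (1 - φ) hη
    obtain ⟨h, hh, s, hs, hxs⟩ := exists_bddAbovePart_of_near_one (J := J) (x := x) hc hη.le hf
      (by simpa [h1, hvx] using (hfφ x (Set.mem_insert x K)).le)
      (fun y hy => by
        have := (abs_lt.1 (hfφ y (Set.mem_insert_of_mem x (not_imp_comm.1 (hKc y) hy)))).2
        simp only [ContinuousMap.sub_apply, ContinuousMap.one_apply,
          h4 y fun h => hy (le_of_lt h.1)] at this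
        linarith) hη1
    exact ⟨h, hh, s, hs, by linarith⟩
  -- If all of `S` vanishes at `x`, evaluating `f + r` there gives `|r| < η / 2`, so `f` alone is
  -- within `η` of the bump and a nonpositive function suffices.
  · push Not at hx0
    obtain ⟨φ, h1, -, h4⟩ := exists_continuousMap_bump (isOpen_lt_rate hJ c) hx
    obtain ⟨f, hf, r, hfφ⟩ := exists_add_const_near S hS (hK.insert x) φ (half_pos hη)
    have hr := abs_lt.1 (hfφ x (Set.mem_insert x K))
    rw [h1, hx0 f hf] at hr
    obtain ⟨h, hh, s, hs, hxs⟩ := exists_negPart_of_near_zero (J := J) (x := x) hc hη.le hf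
      (by simpa [hx0 f hf] using hη.le)
      (fun y hy => by
        have := (abs_lt.1 (hfφ y (Set.mem_insert_of_mem x (not_imp_comm.1 (hKc y) hy)))).1
        rw [h4 y fun h => hy (le_of_lt h)] at this
        linarith) hη1
    exact ⟨h, ⟨hh.1, bddAbove_range_of_mem_negPart hh⟩, s, hs, by linarith⟩

end Recovery


/-! ### From recovery to the variational formulas -/

section Assembly

variable {X ι : Type*} [TopologicalSpace X] [MeasurableSpace X] [OpensMeasurableSpace X]
  [Preorder ι] [IsDirectedOrder ι] [Nonempty ι] {μ : ι → Measure X} {t : ι → ℝ} {J : X → ℝ≥0∞}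

theorem rate_eq_iSup_Lambda [∀ α, IsProbabilityMeasure (μ α)] (ht : ∀ α, 0 < t α)
    (ht0 : Tendsto t atTop (𝓝 0)) (hU : UpperBounds μ t J) (hL : LowerBounds μ t J)
    {B : Set C(X, ℝ)} (hB : ∀ h ∈ B, BddAbove (Set.range (h : X → ℝ))) (x : X)
    (hx : (J x : EReal) ≤ ⨆ h ∈ B, ((h x : EReal) - upperLambda μ t (toEReal h))) :
    (J x : EReal) = ⨆ h ∈ B, ((h x : EReal) - Lambda μ t (toEReal h)) := by
  rw [rate_eq_iSup ht hL subset_rfl x hx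
    (fun h => (limTruncLambda_le ht h).trans (lowerLambda_le_upperLambda _)) fun _ => le_rfl]
  exact biSup_congr fun h hh => by rw [Lambda_eq_upperLambda ht ht0 hU hL (hB h hh)]

theorem rate_eq_iSup_all (ht : ∀ α, 0 < t α) (hL : LowerBounds μ t J) {A B : Set C(X, ℝ)}
    (hBA : B ⊆ A) (x : X)
    (hx : (J x : EReal) ≤ ⨆ h ∈ B, ((h x : EReal) - upperLambda μ t (toEReal h))) :
    (J x : EReal) = ⨆ h ∈ A, ((h x : EReal) - upperLambda μ t (toEReal h)) ∧
    (J x : EReal) = ⨆ h ∈ A, ((h x : EReal) - lowerLambda μ t (toEReal h)) ∧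
    (J x : EReal) = ⨆ h ∈ A, ((h x : EReal) - limTruncLambda μ t h) :=
  ⟨rate_eq_iSup ht hL hBA x hx
    (fun h => (limTruncLambda_le ht h).trans (lowerLambda_le_upperLambda _)) fun _ => le_rfl,
   rate_eq_iSup ht hL hBA x hx (limTruncLambda_le ht) fun _ => lowerLambda_le_upperLambda _,
   rate_eq_iSup ht hL hBA x hx (fun _ => le_rfl) fun h =>
    (limTruncLambda_le ht h).trans (lowerLambda_le_upperLambda _)⟩

end Assembly

end LargeDev

open LargeDev in
theorem mainTheorem4 {X ι : Type*} [TopologicalSpace X] [CompletelyRegularSpace X]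
    [MeasurableSpace X] [BorelSpace X]
    (hcompact : ∀ K : Set X, IsCompact K → MeasurableSet K)
    [Preorder ι] [IsDirectedOrder ι] [Nonempty ι]
    (μ : ι → Measure X) (hμ : ∀ α, IsProbabilityMeasure (μ α))
    (t : ι → ℝ) (ht : ∀ α, 0 < t α) (ht0 : Tendsto t atTop (𝓝 0))
    (J : X → ℝ≥0∞) (hJ : LargeDev.SatisfiesLDP μ t J) :
    -- the quantities below are well defined
    (∀ h ∈ LargeDev.negPart (Set.univ : Set C(X, ℝ)),
      LargeDev.LambdaExists μ t (LargeDev.toEReal h)) ∧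
    (∀ h : C(X, ℝ), ∃ L : EReal,
      Tendsto (fun M : ℝ => LargeDev.lowerLambda μ t (LargeDev.trunc h M)) atTop (𝓝 L)) ∧
    -- the variational form of the rate function without exponential tightness
    (∀ x : X,
      (J x : EReal) = ⨆ h ∈ LargeDev.negPart (Set.univ : Set C(X, ℝ)),
        ((h x : EReal) - LargeDev.Lambda μ t (LargeDev.toEReal h)) ∧
      (J x : EReal) = ⨆ h : C(X, ℝ),
        ((h x : EReal) - LargeDev.upperLambda μ t (LargeDev.toEReal h)) ∧
      (J x : EReal) = ⨆ h : C(X, ℝ),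
        ((h x : EReal) - LargeDev.lowerLambda μ t (LargeDev.toEReal h)) ∧
      (J x : EReal) = ⨆ h : C(X, ℝ),
        ((h x : EReal) - LargeDev.limTruncLambda μ t h)) ∧
    -- the variational form in terms of `A` under exponential tightness
    (LargeDev.ExponentiallyTight μ t →
      ∀ A : Set C(X, ℝ), LargeDev.IsSeparatingAlgebra A ∨ LargeDev.IsWellSeparating A →
        (∀ h ∈ LargeDev.bddAbovePart A, LargeDev.LambdaExists μ t (LargeDev.toEReal h)) ∧
        (∀ x : X,
          (J x : EReal) = ⨆ h ∈ LargeDev.bddAbovePart A,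
            ((h x : EReal) - LargeDev.Lambda μ t (LargeDev.toEReal h)) ∧
          (J x : EReal) = ⨆ h ∈ A,
            ((h x : EReal) - LargeDev.upperLambda μ t (LargeDev.toEReal h)) ∧
          (J x : EReal) = ⨆ h ∈ A,
            ((h x : EReal) - LargeDev.lowerLambda μ t (LargeDev.toEReal h)) ∧
          (J x : EReal) = ⨆ h ∈ A,
            ((h x : EReal) - LargeDev.limTruncLambda μ t h)) ∧
        (LargeDev.VanishesNowhere A → ∀ x : X,
          (J x : EReal) = ⨆ h ∈ LargeDev.negPart A,
            ((h x : EReal) - LargeDev.Lambda μ t (LargeDev.toEReal h)))) := by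
  obtain ⟨hlsc, hU, hL⟩ := hJ.bounds
  have hneg : ∀ (A : Set C(X, ℝ)), ∀ h ∈ negPart A, BddAbove (Set.range (h : X → ℝ)) :=
    fun _ _ => bddAbove_range_of_mem_negPart
  have hexists : ∀ h : C(X, ℝ), BddAbove (Set.range (h : X → ℝ)) → LambdaExists μ t (toEReal h) :=
    fun h hh => ⟨_, tendsto_powIntegral ht ht0 hU hL hh⟩
  refine ⟨fun h hh => hexists h (hneg _ h hh), fun h => ⟨_, tendsto_lowerLambda_trunc ht h⟩,
    fun x => ?_, fun hT A hA => ?_⟩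
  · have hx := le_iSup_sub_upperLambda ht ht0 hU (hneg Set.univ)
      ⟨trivial, fun _ => le_rfl⟩ x
      fun c hc hcx δ hδ => by
        obtain ⟨h, hh, s, hs, hxs⟩ := exists_negPart_univ hlsc hc hcx
        exact ⟨h, hh, s, hs, by linarith⟩
    refine ⟨rate_eq_iSup_Lambda ht ht0 hU hL (hneg _) x hx, ?_⟩
    simpa only [iSup_univ] using rate_eq_iSup_all ht hL (Set.subset_univ _) x hx
  · have := t2Space_of_separating hA
    have h0A : (0 : C(X, ℝ)) ∈ A := by
      rcases hA with ⟨⟨S, rfl⟩, -⟩ | hA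
      · exact S.zero_mem
      · exact hA.1 0
    have hba : ∀ x, (J x : EReal) ≤ ⨆ h ∈ bddAbovePart A,
        ((h x : EReal) - upperLambda μ t (toEReal h)) := by
      refine fun x => le_iSup_sub_upperLambda ht ht0 hU (B := bddAbovePart A) (fun h hh => hh.2)
        ⟨h0A, 0, Set.forall_mem_range.2 fun _ => le_rfl⟩ x fun c hc hcx δ hδ => ?_
      obtain ⟨K, hK, hKc⟩ := hT.exists_isCompact hL c
      rcases hA with ⟨⟨S, rfl⟩, hS⟩ | hA
      · exact exists_bddAbovePart_of_separating hS hlsc hc hδ hK hKc hcx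
      · obtain ⟨h, hh, s, hs, hxs⟩ := hA.exists_negPart hlsc hK hKc hcx
        exact ⟨h, ⟨hh.1, hneg A h hh⟩, s, hs, by linarith⟩
    refine ⟨fun h hh => hexists h hh.2, fun x => ⟨rate_eq_iSup_Lambda ht ht0 hU hL
      (fun h hh => hh.2) x (hba x), rate_eq_iSup_all ht hL (fun h hh => hh.1) x (hba x)⟩,
      fun hA0 x => rate_eq_iSup_Lambda ht ht0 hU hL (hneg A) x ?_⟩
    refine le_iSup_sub_upperLambda ht ht0 hU (hneg A) ⟨h0A, fun _ => le_rfl⟩ x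
      fun c hc hcx δ hδ => ?_
    obtain ⟨K, hK, hKc⟩ := hT.exists_isCompact hL c
    rcases hA with ⟨⟨S, rfl⟩, hS⟩ | hA
    · exact exists_negPart_of_vanishesNowhere hS hA0 hlsc hc hδ hK hKc hcx
    · obtain ⟨h, hh, s, hs, hxs⟩ := hA.exists_negPart hlsc hK hKc hcx
      exact ⟨h, hh, s, hs, by linarith⟩
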